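/- For an integer $k$ let $a_{2k}=\zeta(1-2k)$ if $k\neq 0$ and $a_0=2\zeta'(0)=-\log 2\pi$, where $\zeta$ is the Riemann zeta-function, and for $z$ in the upper half-plane ($\operatorname{Im} z>0$) define, with $q=e^{2\pi i z}$, $$E_{2k}(z)=1+\frac{2}{a_{2k}}\sum_{l=1}^{\infty}\frac{l^{2k-1}q^l}{1-q^l}.$$ Let $B_n$ denote the Bernoulli numbers, $\delta_{k0}$ Kronecker's symbol, and take the branch of $\log z$ with $0<\arg z<\pi$. Then for every integer $k$ and every $z$ with $\operatorname{Im} z>0$, $$E_{2k}\Bigl(-\frac1z\Bigr)=z^{2k}\biggl\{E_{2k}(z)+\frac{(-2\pi i)^{1-2k}}{a_{2k}}\biggl[\Bigl(\frac{\log z}{2\pi i}-\frac14\Bigr)\delta_{k0}+\sum_{j=0}^{1-k}\frac{B_{2j}B_{2-2k-2j}}{(2j)!\,(2-2k-2j)!}z^{1-2k-2j}\biggr]\biggr\},$$ where the sum is empty if $k\geq 2$. In particular, $$E_0\Bigl(-\frac1z\Bigr)=E_0(z)+\frac{1}{\log 2\pi}\Bigl(\log z-\frac{\pi i}{2}+\frac{\pi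 i z}{6}+\frac{\pi i}{6z}\Bigr),$$ $$E_2\Bigl(-\frac1z\Bigr)=z^2E_2(z)+\frac{6z}{\pi i}.$$ -/

import Mathlib

/-- The normalizing constant `a_{2k}`: `ζ(1 - 2k)` for `k ≠ 0`, and `2 ζ'(0)` for `k = 0`. -/
noncomputable def eisensteinConst (k : ℤ) : ℂ :=
  if k = 0 then 2 * deriv riemannZeta 0 else riemannZeta (1 - 2 * k)

/-- `2 ζ'(0) = -log 2π`. -/
theorem eisensteinConst_zero : eisensteinConst 0 = -(Real.log (2 * Real.pi) : ℂ) := by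
  have h : (2 * Real.pi : ℂ) = ((2 * Real.pi : ℝ) : ℂ) := by push_cast; rfl
  rw [eisensteinConst, if_pos rfl, deriv_riemannZeta_zero, h,
    ← Complex.ofReal_log (by positivity)]
  ring

/-- The term `l^{2k-1} q^l / (1 - q^l)`, where `q = e^{2πiz}`. -/
noncomputable def eisensteinTerm (k : ℤ) (z : ℂ) (l : ℕ+) : ℂ :=
  (l : ℂ) ^ (2 * k - 1) * Complex.exp (2 * Real.pi * Complex.I * z) ^ (l : ℕ) /
    (1 - Complex.exp (2 * Real.pi * Complex.I * z) ^ (l : ℕ))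

/-- The classical Eisenstein series `E_{2k}(z)` of weight `2k`, for any integer `k`
and `z` in the upper half-plane. -/
noncomputable def eisensteinE (k : ℤ) (z : ℂ) : ℂ :=
  1 + 2 / eisensteinConst k * ∑' l : ℕ+, eisensteinTerm k z l

/-- The series defining `E_{2k}(z)` converges absolutely in the upper half-plane. -/
theorem summable_eisensteinTerm (k : ℤ) {z : ℂ} (hz : 0 < z.im) :
    Summable (eisensteinTerm k z) := by
  obtain ⟨q, hq⟩ : ∃ q, q = Complex.exp (2 * Real.pi * Complex.I * z) := ⟨_, rfl⟩
  have hq1 : ‖q‖ < 1 := by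
    rw [hq, Complex.norm_exp, Real.exp_lt_one_iff]
    have : (2 * Real.pi * Complex.I * z).re = -(2 * Real.pi * z.im) := by
      simp [Complex.mul_re, Complex.mul_im]
    rw [this]
    have := Real.pi_pos
    simp only [Left.neg_neg_iff]
    positivity
  obtain ⟨m, hm⟩ : ∃ m : ℕ, 2 * k - 1 ≤ (m : ℤ) :=
    ⟨(2 * k - 1).toNat, Int.self_le_toNat _⟩
  have hq2 : ‖‖q‖‖ < 1 := by rwa [norm_norm]
  have hs0 : Summable fun n : ℕ => (n : ℝ) ^ m * ‖q‖ ^ n :=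
    summable_pow_mul_geometric_of_norm_lt_one m hq2
  have hs : Summable fun n : ℕ => (n : ℝ) ^ m * ‖q‖ ^ n * (1 - ‖q‖)⁻¹ :=
    hs0.mul_right _
  have hs' : Summable fun l : ℕ+ => ((l : ℕ) : ℝ) ^ m * ‖q‖ ^ (l : ℕ) * (1 - ‖q‖)⁻¹ :=
    hs.comp_injective PNat.coe_injective
  refine Summable.of_norm_bounded hs' fun l => ?_
  have hl : (1 : ℝ) ≤ (l : ℕ) := by exact_mod_cast l.2
  have hd : 1 - ‖q‖ ≤ ‖1 - q ^ (l : ℕ)‖ := by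
    have h1 := norm_sub_norm_le (1 : ℂ) (q ^ (l : ℕ))
    rw [norm_one, norm_pow] at h1
    have h2 : ‖q‖ ^ (l : ℕ) ≤ ‖q‖ := pow_le_of_le_one (norm_nonneg _) hq1.le l.ne_zero
    linarith
  have hp : ((l : ℕ) : ℝ) ^ (2 * k - 1) ≤ ((l : ℕ) : ℝ) ^ m := by
    rw [← zpow_natCast]
    exact zpow_le_zpow_right₀ hl hm
  have hpos : 0 < 1 - ‖q‖ := by linarith
  simp only [eisensteinTerm, ← hq]
  rw [norm_div, norm_mul, norm_zpow, norm_pow, div_eq_mul_inv]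
  have hn : ‖((l : ℕ) : ℂ)‖ = ((l : ℕ) : ℝ) := by simp
  rw [hn]
  gcongr

/-!
For `k ≥ 2` the claim is the modularity of the Eisenstein series of weight `2k`, and for `k = 1` the
transformation law of `E₂`. For `k = 0`, `πiz/12 - ∑ l⁻¹ q^l / (1 - q^l)` is the logarithm of the
Dedekind eta function and has derivative `(πi/12) E₂`; integrating the law of weight `2` gives that
of weight `0` up to a constant, which is found at the fixed point `i` of `z ↦ -1/z`.

For `k = -p < 0`, `ζ(2p+1) E_{2k}(z) = i ∑ l^{-2p-1} cot(πlz)`, which the partial fractions of the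
cotangent turn into the double series `∑ 1 / (l^{2p} (l²z² - m²))` over `l, m ≥ 1`. The substitution
`z ↦ -1/z` amounts to exchanging `l` and `m`. Since `l²z² ≡ m²` modulo `l²z² - m²`, exchanging the
powers `l^{-2p}` and `m^{-2p}` costs a finite sum of terms `l^{-2i} m^{-2j}` with `i + j = p + 1`,
which contribute the products `ζ(2i) ζ(2j)`, that is, the products of Bernoulli numbers.
-/

section

open Complex (I exp log)
open Finset.HasAntidiagonal (antidiagonal mem_antidiagonal)
open scoped Real ArithmeticFunction.sigma

variable {z : ℂ}

theorem ne_zero_of_im_pos (hz : 0 < z.im) : z ≠ 0 :=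
  UpperHalfPlane.ne_zero ⟨z, hz⟩

theorem im_neg_one_div_pos (hz : 0 < z.im) : 0 < (-1 / z).im := by
  rw [neg_div, one_div, ← inv_neg]
  exact UpperHalfPlane.im_inv_neg_coe_pos ⟨z, hz⟩

theorem norm_exp_two_pi_I_mul_lt_one (hz : 0 < z.im) : ‖exp (2 * π * I * z)‖ < 1 :=
  UpperHalfPlane.norm_exp_two_pi_I_lt_one ⟨z, hz⟩

theorem one_sub_pow_ne_zero {q : ℂ} (hq : ‖q‖ < 1) (l : ℕ+) : 1 - q ^ (l : ℕ) ≠ 0 := by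
  refine sub_ne_zero.mpr fun h => ?_
  have hlt : ‖q ^ (l : ℕ)‖ < 1 := by
    rw [norm_pow]
    exact pow_lt_one₀ (norm_nonneg q) hq l.ne_zero
  exact hlt.ne (by rw [← h, norm_one])

/-- The Lambert series `∑ l^{2k-1} q^l / (1 - q^l)` of `E_{2k}`, without its normalization. -/
noncomputable def lambertSeries (k : ℤ) (z : ℂ) : ℂ :=
  ∑' l : ℕ+, eisensteinTerm k z l

theorem eisensteinE_eq_lambertSeries (k : ℤ) (z : ℂ) :
    eisensteinE k z = 1 + 2 / eisensteinConst k * lambertSeries k z :=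
  rfl

theorem eisensteinConst_natCast {m : ℕ} (hm : m ≠ 0) :
    eisensteinConst m = -(bernoulli (2 * m) : ℂ) / (2 * m) := by
  have hneg : 1 - 2 * ((m : ℤ) : ℂ) = -((2 * m - 1 : ℕ) : ℂ) := by
    rw [Nat.cast_sub (by omega)]
    push_cast
    ring
  rw [eisensteinConst, if_neg (by omega), hneg, riemannZeta_neg_nat_eq_bernoulli',
    show 2 * m - 1 + 1 = 2 * m by omega, bernoulli_eq_bernoulli'_of_ne_one (by omega),
    Nat.cast_sub (by omega)]
  push_cast
  ring

theorem eisensteinConst_one : eisensteinConst 1 = -1 / 12 := by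
  have h := eisensteinConst_natCast one_ne_zero
  norm_num [bernoulli_two] at h ⊢
  exact h

theorem lambertSeries_natCast {m : ℕ} (hm : m ≠ 0) (hz : 0 < z.im) :
    lambertSeries m z = ∑' n : ℕ+, (σ (2 * m - 1) n : ℂ) * exp (2 * π * I * z) ^ (n : ℕ) := by
  rw [← tsum_pow_div_one_sub_eq_tsum_sigma (norm_exp_two_pi_I_mul_lt_one hz)]
  refine tsum_congr fun l => ?_
  rw [eisensteinTerm, show 2 * (m : ℤ) - 1 = (2 * m - 1 : ℕ) by omega, zpow_natCast]

theorem eisensteinE_natCast {m : ℕ} (hm : m ≠ 0) (hz : 0 < z.im) :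
    eisensteinE m z = 1 - 2 * (2 * m : ℕ) / (bernoulli (2 * m) : ℂ) *
      ∑' n : ℕ+, (σ (2 * m - 1) n : ℂ) * exp (2 * π * I * z) ^ (n : ℕ) := by
  rw [eisensteinE_eq_lambertSeries, eisensteinConst_natCast hm, lambertSeries_natCast hm hz,
    div_div_eq_mul_div, div_neg, neg_mul, ← sub_eq_add_neg]
  push_cast
  rfl

theorem eisensteinE_coe_eq_modularForm {m : ℕ} (hm : 3 ≤ 2 * m) (τ : UpperHalfPlane) :
    eisensteinE m τ = ModularForm.E hm τ := by
  rw [eisensteinE_natCast (by omega) τ.im_pos,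
    EisensteinSeries.q_expansion_bernoulli hm (even_two_mul m)]
  simp only [zpow_natCast]

theorem eisensteinE_neg_one_div_of_two_le {k : ℤ} (hk : 2 ≤ k) (hz : 0 < z.im) :
    eisensteinE k (-1 / z) = z ^ (2 * k) * eisensteinE k z := by
  lift k to ℕ using by omega with m
  have hm : 3 ≤ 2 * m := by omega
  have hS : Matrix.SpecialLinearGroup.mapGL ℝ ModularGroup.S ∈
      (Matrix.SpecialLinearGroup.mapGL ℝ : _ →* GL (Fin 2) ℝ).range := ⟨_, rfl⟩
  have hslash :=
    (SlashInvariantForm.slash_S_apply (ModularForm.E hm) (2 * m : ℕ) ⟨z, hz⟩).symm.trans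
      (congrFun (SlashInvariantForm.slash_action_eqn (ModularForm.E hm) _ hS) ⟨z, hz⟩)
  rw [← eisensteinE_coe_eq_modularForm, ← eisensteinE_coe_eq_modularForm] at hslash
  have hz0 := ne_zero_of_im_pos hz
  rw [← hslash, neg_div, one_div, ← inv_neg, zpow_neg]
  push_cast
  field_simp

theorem eisensteinE_coe_eq_E2 (τ : UpperHalfPlane) :
    eisensteinE 1 τ = EisensteinSeries.E2 τ := by
  have h := eisensteinE_natCast one_ne_zero τ.im_pos
  rw [EisensteinSeries.E2_eq_tsum_cexp]
  norm_num [bernoulli_two] at h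
  exact h

theorem eisensteinE_one_neg_one_div (hz : 0 < z.im) :
    eisensteinE 1 (-1 / z) = z ^ 2 * eisensteinE 1 z + 6 * z / (π * I) := by
  have hz0 := ne_zero_of_im_pos hz
  have hG2 := EisensteinSeries.G2_S_transform ⟨z, hz⟩
  have hE := eisensteinE_coe_eq_E2 ⟨z, hz⟩
  have hE' := eisensteinE_coe_eq_E2 ⟨_, UpperHalfPlane.im_inv_neg_coe_pos ⟨z, hz⟩⟩
  simp only [UpperHalfPlane.modular_S_smul, EisensteinSeries.E2, Pi.smul_apply, smul_eq_mul,
    riemannZeta_two] at hG2 hE hE'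
  rw [neg_div, one_div, ← inv_neg, hE', hE, hG2]
  field_simp
  linear_combination (-2 * z * π) * Complex.I_sq

theorem norm_exp_two_pi_I_mul (z : ℂ) : ‖exp (2 * π * I * z)‖ = Real.exp (-(2 * π * z.im)) := by
  rw [Complex.norm_exp]
  simp

theorem norm_eisensteinTerm_le {y : ℝ} (hy : 0 < y) (hyz : y ≤ z.im) (k : ℤ) (l : ℕ+) :
    ‖eisensteinTerm k z l‖ ≤ ‖eisensteinTerm k (y * I) l‖ := by
  set q := exp (2 * π * I * z)
  set r := Real.exp (-(2 * π * y))
  have hr : exp (2 * π * I * (y * I)) = (r : ℂ) := by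
    rw [Complex.ofReal_exp]
    congr 1
    push_cast
    linear_combination (2 * π * y) * Complex.I_sq
  have hqr : ‖q‖ ^ (l : ℕ) ≤ r ^ (l : ℕ) := by
    rw [norm_exp_two_pi_I_mul]
    simp only [r]
    gcongr
  have hr1 : 0 < 1 - r ^ (l : ℕ) :=
    sub_pos.mpr (pow_lt_one₀ (Real.exp_nonneg _)
      (Real.exp_lt_one_iff.mpr (neg_lt_zero.mpr (by positivity))) l.ne_zero)
  have hden : ‖1 - (r : ℂ) ^ (l : ℕ)‖ = 1 - r ^ (l : ℕ) := by
    rw [← Complex.ofReal_pow, ← Complex.ofReal_one, ← Complex.ofReal_sub,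
      Complex.norm_of_nonneg hr1.le]
  have hden_le : 1 - r ^ (l : ℕ) ≤ ‖1 - q ^ (l : ℕ)‖ := by
    have h := norm_sub_norm_le 1 (q ^ (l : ℕ))
    rw [norm_one, norm_pow] at h
    linarith
  rw [eisensteinTerm, eisensteinTerm, hr, norm_div, norm_div, norm_mul, norm_mul, hden, norm_pow,
    norm_pow, Complex.norm_of_nonneg (Real.exp_nonneg _)]
  gcongr

theorem hasDerivAt_eisensteinTerm (k : ℤ) (hz : 0 < z.im) (l : ℕ+) :
    HasDerivAt (fun w => eisensteinTerm k w l)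
      (2 * π * I * ((l : ℂ) ^ (2 * k) * exp (2 * π * I * z) ^ (l : ℕ) /
        (1 - exp (2 * π * I * z) ^ (l : ℕ)) ^ 2)) z := by
  have hne := one_sub_pow_ne_zero (norm_exp_two_pi_I_mul_lt_one hz) l
  have hq : HasDerivAt (fun w => exp (2 * π * I * w) ^ (l : ℕ))
      (2 * π * I * l * exp (2 * π * I * z) ^ (l : ℕ)) z := by
    have h := ((hasDerivAt_id z).const_mul (l * (2 * π * I))).cexp
    simp only [id, mul_one, mul_assoc (l : ℂ), Complex.exp_nat_mul] at h
    exact h.congr_deriv (by ring)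
  refine ((hq.const_mul ((l : ℂ) ^ (2 * k - 1))).div (hq.const_sub 1) hne).congr_deriv ?_
  have hl : (l : ℂ) ≠ 0 := by exact_mod_cast l.ne_zero
  rw [zpow_sub_one₀ hl]
  field_simp
  ring

theorem hasDerivAt_lambertSeries (k : ℤ) (hz : 0 < z.im) :
    HasDerivAt (lambertSeries k)
      (2 * π * I * ∑' l : ℕ+, (l : ℂ) ^ (2 * k) * exp (2 * π * I * z) ^ (l : ℕ) /
        (1 - exp (2 * π * I * z) ^ (l : ℕ)) ^ 2) z := by
  let U : Set ℂ := {w | z.im / 2 < w.im}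
  have hU : IsOpen U := isOpen_lt continuous_const Complex.continuous_im
  have hzU : z ∈ U := half_lt_self hz
  have hdiff (l : ℕ+) : DifferentiableOn ℂ (fun w => eisensteinTerm k w l) U := fun w hw =>
    (hasDerivAt_eisensteinTerm k ((half_pos hz).trans hw) l).differentiableAt.differentiableWithinAt
  have hbound (l : ℕ+) (w : ℂ) (hw : w ∈ U) :
      ‖eisensteinTerm k w l‖ ≤ ‖eisensteinTerm k ((z.im / 2 : ℝ) * I) l‖ :=
    norm_eisensteinTerm_le (half_pos hz) (le_of_lt hw) k l
  have hsum : Summable fun l => ‖eisensteinTerm k ((z.im / 2 : ℝ) * I) l‖ :=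
    (summable_eisensteinTerm k (by simpa using hz)).norm
  have hderiv := (Complex.hasSum_deriv_of_summable_norm hsum hdiff hU hbound hzU).tsum_eq
  rw [tsum_congr fun l => (hasDerivAt_eisensteinTerm k hz l).deriv, tsum_mul_left] at hderiv
  rw [hderiv]
  exact ((Complex.differentiableOn_tsum_of_summable_norm hsum hdiff hU hbound).differentiableAt
    (hU.mem_nhds hzU)).hasDerivAt

theorem tsum_pow_div_one_sub_pow_sq {q : ℂ} (hq : ‖q‖ < 1) :
    ∑' l : ℕ+, q ^ (l : ℕ) / (1 - q ^ (l : ℕ)) ^ 2 = ∑' n : ℕ+, (σ 1 n : ℂ) * q ^ (n : ℕ) := by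
  rw [← tsum_prod_pow_eq_tsum_sigma 1 hq]
  refine tsum_congr fun l => ?_
  have hql : ‖q ^ (l : ℕ)‖ < 1 := by
    rw [norm_pow]
    exact pow_lt_one₀ (norm_nonneg q) hq l.ne_zero
  rw [← tsum_coe_mul_geometric_of_norm_lt_one hql, ← tsum_zero_pnat_eq_tsum_nat]
  · simp [pow_mul]
  · simpa using summable_pow_mul_geometric_of_norm_lt_one 1 hql

theorem hasDerivAt_lambertSeries_zero (hz : 0 < z.im) :
    HasDerivAt (lambertSeries 0) (2 * π * I * lambertSeries 1 z) z := by
  have h := hasDerivAt_lambertSeries 0 hz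
  simp only [mul_zero, zpow_zero, one_mul,
    tsum_pow_div_one_sub_pow_sq (norm_exp_two_pi_I_mul_lt_one hz)] at h
  exact h.congr_deriv (congrArg _ (lambertSeries_natCast one_ne_zero hz).symm)

/-- The logarithm of the Dedekind eta function `q^{1/24} ∏ (1 - q^n)`, with the logarithm of the
product expanded as a Lambert series. -/
noncomputable def logEta (z : ℂ) : ℂ :=
  π * I * z / 12 - lambertSeries 0 z

theorem hasDerivAt_logEta (hz : 0 < z.im) :
    HasDerivAt logEta (π * I / 12 * eisensteinE 1 z) z := by
  have hlin : HasDerivAt (fun w : ℂ => π * I * w / 12) (π * I / 12) z := by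
    simpa using ((hasDerivAt_id z).const_mul (π * I)).div_const 12
  refine (hlin.sub (hasDerivAt_lambertSeries_zero hz)).congr_deriv ?_
  rw [eisensteinE_eq_lambertSeries, eisensteinConst_one]
  ring

theorem logEta_neg_one_div (hz : 0 < z.im) :
    logEta (-1 / z) = logEta z + log z / 2 - π * I / 4 := by
  let U : Set ℂ := {w | 0 < w.im}
  have hinv {w : ℂ} (hw : w ∈ U) : HasDerivAt (fun w => -1 / w) (1 / w ^ 2) w := by
    have h := (hasDerivAt_inv (ne_zero_of_im_pos hw)).const_mul (-1)
    simp only [← div_eq_mul_inv] at h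
    exact h.congr_deriv (by ring)
  have hleft {w : ℂ} (hw : w ∈ U) : HasDerivAt (fun w => logEta (-1 / w))
      (π * I / 12 * eisensteinE 1 w + w⁻¹ / 2) w := by
    refine ((hasDerivAt_logEta (im_neg_one_div_pos hw)).comp w (hinv hw)).congr_deriv ?_
    have hw0 := ne_zero_of_im_pos hw
    rw [eisensteinE_one_neg_one_div hw]
    field_simp
    ring
  have hright {w : ℂ} (hw : w ∈ U) : HasDerivAt (fun w => logEta w + log w / 2 - π * I / 4)
      (π * I / 12 * eisensteinE 1 w + w⁻¹ / 2) w :=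
    ((hasDerivAt_logEta hw).add
      ((Complex.hasDerivAt_log (.inr (ne_of_gt hw))).div_const 2)).sub_const _
  refine (isOpen_lt continuous_const Complex.continuous_im).eqOn_of_deriv_eq
    (convex_halfSpace_im_gt 0).isPreconnected
    (fun w hw => (hleft hw).differentiableAt.differentiableWithinAt)
    (fun w hw => (hright hw).differentiableAt.differentiableWithinAt)
    (fun w hw => (hleft hw).deriv.trans (hright hw).deriv.symm)
    (show I ∈ U by simp [U]) ?_ hz
  have hfix : -1 / I = I := by simp [neg_div]
  rw [hfix, Complex.log_I]
  ring

theorem eisensteinE_zero_neg_one_div (hz : 0 < z.im) :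
    eisensteinE 0 (-1 / z) = eisensteinE 0 z + 1 / (Real.log (2 * π) : ℂ) *
      (log z - π * I / 2 + π * I * z / 6 + π * I / (6 * z)) := by
  have h := logEta_neg_one_div hz
  simp only [logEta] at h
  rw [eisensteinE_eq_lambertSeries, eisensteinE_eq_lambertSeries, eisensteinConst_zero, div_neg]
  linear_combination (2 / (Real.log (2 * π) : ℂ)) * h

theorem inv_pow_mul_sub_eq {K : Type*} [Field K] {x y t : K} (hx : x ≠ 0) (hy : y ≠ 0)
    (hxy : x * t - y ≠ 0) (n : ℕ) :
    (x ^ (n + 1) * (x * t - y))⁻¹ = t ^ (n + 1) * (y ^ (n + 1) * (x * t - y))⁻¹ -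
      ∑ i ∈ antidiagonal n, t ^ i.1 * ((y ^ (i.1 + 1))⁻¹ * (x ^ (i.2 + 1))⁻¹) := by
  have hterm : ∀ i ∈ antidiagonal n,
      t ^ i.1 * ((y ^ (i.1 + 1))⁻¹ * (x ^ (i.2 + 1))⁻¹) =
        (x * t) ^ i.1 * y ^ i.2 * ((x * y) ^ (n + 1))⁻¹ := by
    rintro ⟨i, j⟩ hij
    obtain rfl : i + j = n := mem_antidiagonal.mp hij
    field_simp
    ring
  have hgeom : (∑ i ∈ antidiagonal n, (x * t) ^ i.1 * y ^ i.2) * (x * t - y) =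
      (x * t) ^ (n + 1) - y ^ (n + 1) := by
    rw [← geom_sum₂_mul, Finset.Nat.sum_antidiagonal_eq_sum_range_succ
      (fun i j => (x * t) ^ i * y ^ j)]
    rfl
  rw [Finset.sum_congr rfl hterm, ← Finset.sum_mul, eq_div_of_mul_eq hxy hgeom]
  field_simp
  ring

theorem sq_mul_im_sq_le_norm (z : ℂ) (a b : ℝ) :
    a ^ 2 * z.im ^ 2 ≤ ‖(a : ℂ) ^ 2 * z ^ 2 - b ^ 2‖ := by
  have hadd : |a * z.im| ≤ ‖a * z + b‖ := by simpa using Complex.abs_im_le_norm (a * z + b)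
  have hsub : |a * z.im| ≤ ‖a * z - b‖ := by simpa using Complex.abs_im_le_norm (a * z - b)
  calc a ^ 2 * z.im ^ 2 = |a * z.im| * |a * z.im| := by rw [abs_mul_abs_self]; ring
    _ ≤ ‖a * z + b‖ * ‖a * z - b‖ := by gcongr
    _ = ‖(a : ℂ) ^ 2 * z ^ 2 - b ^ 2‖ := by rw [← norm_mul]; ring_nf

theorem sq_mul_sq_sub_sq_eq (hz : z ≠ 0) (a b : ℂ) :
    a ^ 2 * z ^ 2 - b ^ 2 = -z ^ 2 * (b ^ 2 * (-1 / z) ^ 2 - a ^ 2) := by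
  field_simp
  ring

theorem sq_mul_sq_sub_sq_ne_zero (hz : 0 < z.im) (l m : ℕ+) :
    (l : ℂ) ^ 2 * z ^ 2 - (m : ℂ) ^ 2 ≠ 0 := by
  have h := sq_mul_im_sq_le_norm z l m
  have hpos : (0 : ℝ) < (l : ℝ) ^ 2 * z.im ^ 2 := by positivity
  exact norm_pos_iff.mp (hpos.trans_le (by simpa using h))

theorem hasSum_pnat_inv_pow {n : ℕ} (hn : 1 < n) :
    HasSum (fun l : ℕ+ => ((l : ℂ) ^ n)⁻¹) (riemannZeta n) := by
  have hs : Summable fun l : ℕ => ((l : ℂ) ^ n)⁻¹ := by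
    simpa using Complex.summable_one_div_nat_cpow (p := n).mpr (by simpa using hn)
  have hzeta := tsum_zero_pnat_eq_tsum_nat hs
  simp only [Nat.cast_zero, zero_pow (by omega : n ≠ 0), inv_zero, zero_add] at hzeta
  simp only [← one_div, ← zeta_nat_eq_tsum_of_gt_one hn] at hzeta
  rw [← hzeta]
  simpa [Function.comp_def] using (hs.comp_injective PNat.coe_injective).hasSum

theorem hasSum_prod_mul_of_summable_norm {ι κ R : Type*} [NormedRing R] [CompleteSpace R]
    {f : ι → R} {g : κ → R} {a b : R} (hf : HasSum f a) (hg : HasSum g b)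
    (hf' : Summable fun i => ‖f i‖) (hg' : Summable fun j => ‖g j‖) :
    HasSum (fun x : ι × κ => f x.1 * g x.2) (a * b) :=
  hf.mul hg (summable_mul_of_summable_norm hf' hg')

theorem hasSum_pnat_prod_inv_pow {m n : ℕ} (hm : 1 < m) (hn : 1 < n) :
    HasSum (fun x : ℕ+ × ℕ+ => ((x.1 : ℂ) ^ m)⁻¹ * ((x.2 : ℂ) ^ n)⁻¹)
      (riemannZeta m * riemannZeta n) := by
  have hm := hasSum_pnat_inv_pow hm
  have hn := hasSum_pnat_inv_pow hn
  have h := hasSum_prod_mul_of_summable_norm hm hn hm.summable.norm hn.summable.norm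
  simpa only using h

/-- The general term of the double series `∑ 1 / (l^{2p} (l²z² - m²))`, which arises from
`∑ l^{-2p-1} cot(πlz)` by the partial fraction expansion of the cotangent. -/
noncomputable def cotLatticeTerm (p : ℕ) (z : ℂ) (x : ℕ+ × ℕ+) : ℂ :=
  ((x.1 : ℂ) ^ (2 * p) * ((x.1 : ℂ) ^ 2 * z ^ 2 - (x.2 : ℂ) ^ 2))⁻¹

theorem summable_cotLatticeTerm {p : ℕ} (hp : p ≠ 0) (hz : 0 < z.im) :
    Summable (cotLatticeTerm p z) := by
  have hz0 := ne_zero_of_im_pos hz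
  have hw := im_neg_one_div_pos hz
  set c : ℝ := ‖z‖ ^ 2 * (-1 / z).im ^ 2
  have : 0 < c := by positivity
  have hbound (l m : ℕ+) : (m : ℝ) ^ 2 * c ≤ ‖(l : ℂ) ^ 2 * z ^ 2 - (m : ℂ) ^ 2‖ := by
    have h := sq_mul_im_sq_le_norm (-1 / z) m l
    rw [sq_mul_sq_sub_sq_eq hz0, norm_mul, norm_neg, norm_pow]
    calc (m : ℝ) ^ 2 * c = ‖z‖ ^ 2 * ((m : ℝ) ^ 2 * (-1 / z).im ^ 2) := by ring
      _ ≤ _ := by gcongr; simpa using h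
  have hs := (hasSum_pnat_prod_inv_pow (m := 2 * p) (by omega)
    one_lt_two).summable.norm.mul_right c⁻¹
  refine .of_norm_bounded hs fun x => ?_
  simp only [cotLatticeTerm, norm_inv, norm_mul, norm_pow, Complex.norm_natCast]
  rw [mul_assoc, ← mul_inv, ← mul_inv]
  gcongr
  exact hbound x.1 x.2

theorem cotLatticeTerm_reciprocity (n : ℕ) (hz : 0 < z.im) (l m : ℕ+) :
    z ^ 2 * cotLatticeTerm (n + 1) z (l, m) =
      -(z ^ (2 * (n + 1)) * cotLatticeTerm (n + 1) (-1 / z) (m, l)) -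
        ∑ i ∈ antidiagonal n, z ^ (2 * (i.1 + 1)) *
          (((l : ℂ) ^ (2 * (i.2 + 1)))⁻¹ * ((m : ℂ) ^ (2 * (i.1 + 1)))⁻¹) := by
  have hz0 := ne_zero_of_im_pos hz
  have hl : (l : ℂ) ≠ 0 := by exact_mod_cast l.ne_zero
  have hm : (m : ℂ) ≠ 0 := by exact_mod_cast m.ne_zero
  have hswap : z ^ 2 * (((m : ℂ) ^ 2) ^ (n + 1) * ((l : ℂ) ^ 2 * z ^ 2 - (m : ℂ) ^ 2))⁻¹ =
      -cotLatticeTerm (n + 1) (-1 / z) (m, l) := by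
    rw [cotLatticeTerm, sq_mul_sq_sub_sq_eq hz0 l m, pow_mul, mul_inv, mul_inv, mul_inv, inv_neg]
    field_simp
  rw [cotLatticeTerm, pow_mul, inv_pow_mul_sub_eq (pow_ne_zero 2 hl) (pow_ne_zero 2 hm)
    (sq_mul_sq_sub_sq_ne_zero hz l m), mul_sub, mul_left_comm, hswap, ← pow_mul, mul_neg,
    Finset.mul_sum]
  congr 1
  refine Finset.sum_congr rfl fun i _ => ?_
  simp only [← pow_mul]
  ring

theorem tsum_cotLatticeTerm_reciprocity (n : ℕ) (hz : 0 < z.im) :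
    z ^ 2 * ∑' x, cotLatticeTerm (n + 1) z x =
      -(z ^ (2 * (n + 1)) * ∑' x, cotLatticeTerm (n + 1) (-1 / z) x) -
        ∑ i ∈ antidiagonal n, z ^ (2 * (i.1 + 1)) *
          (riemannZeta (2 * (i.2 + 1) : ℕ) * riemannZeta (2 * (i.1 + 1) : ℕ)) := by
  have hswap := (Equiv.prodComm ℕ+ ℕ+).hasSum_iff.mpr
    (summable_cotLatticeTerm n.succ_ne_zero (im_neg_one_div_pos hz)).hasSum
  have hzeta := hasSum_sum fun i (_ : i ∈ antidiagonal n) =>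
    (hasSum_pnat_prod_inv_pow (m := 2 * (i.2 + 1)) (n := 2 * (i.1 + 1)) (by omega)
      (by omega)).mul_left (z ^ (2 * (i.1 + 1)))
  rw [← tsum_mul_left, ← ((hswap.mul_left (z ^ (2 * (n + 1)))).neg.sub hzeta).tsum_eq]
  exact tsum_congr fun x => cotLatticeTerm_reciprocity n hz x.1 x.2

theorem I_mul_cot_pi_mul (hz : 0 < z.im) :
    I * Complex.cot (π * z) = 1 + 2 * (exp (2 * π * I * z) / (1 - exp (2 * π * I * z))) := by
  have hq : 1 - exp (2 * π * I * z) ≠ 0 := by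
    simpa using one_sub_pow_ne_zero (norm_exp_two_pi_I_mul_lt_one hz) 1
  rw [Complex.cot_pi_eq_exp_ratio, ← mul_div_assoc, mul_div_mul_left _ _ Complex.I_ne_zero]
  field_simp
  ring

theorem natCast_mul_im_pos (hz : 0 < z.im) (l : ℕ+) : 0 < (l * z).im := by
  have hl : (0 : ℝ) < l := by exact_mod_cast l.pos
  simpa using mul_pos hl hz

theorem eisensteinConst_neg {p : ℕ} (hp : p ≠ 0) :
    eisensteinConst (-p) = riemannZeta (2 * p + 1 : ℕ) := by
  rw [eisensteinConst, if_neg (by omega)]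
  congr 1
  push_cast
  ring

theorem riemannZeta_natCast_ne_zero {n : ℕ} (hn : 1 < n) : riemannZeta n ≠ 0 :=
  riemannZeta_ne_zero_of_one_lt_re (by exact_mod_cast hn)

theorem hasSum_inv_pow_mul_I_mul_cot {p : ℕ} (hp : p ≠ 0) (hz : 0 < z.im) :
    HasSum (fun l : ℕ+ => ((l : ℂ) ^ (2 * p + 1))⁻¹ * (I * Complex.cot (π * (l * z))))
      (riemannZeta (2 * p + 1 : ℕ) * eisensteinE (-p) z) := by
  have hterm (l : ℕ+) : ((l : ℂ) ^ (2 * p + 1))⁻¹ * (I * Complex.cot (π * (l * z))) =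
      ((l : ℂ) ^ (2 * p + 1))⁻¹ + 2 * eisensteinTerm (-p) z l := by
    have hexp : exp (2 * π * I * (l * z)) = exp (2 * π * I * z) ^ (l : ℕ) := by
      rw [← Complex.exp_nat_mul]
      ring_nf
    rw [I_mul_cot_pi_mul (natCast_mul_im_pos hz l), hexp, eisensteinTerm,
      show 2 * (-p : ℤ) - 1 = -((2 * p + 1 : ℕ) : ℤ) by push_cast; ring, zpow_neg, zpow_natCast]
    ring
  have hsum : riemannZeta (2 * p + 1 : ℕ) * eisensteinE (-p) z =
      riemannZeta (2 * p + 1 : ℕ) + 2 * ∑' l : ℕ+, eisensteinTerm (-p) z l := by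
    have hzeta := riemannZeta_natCast_ne_zero (n := 2 * p + 1) (by omega)
    rw [eisensteinE, eisensteinConst_neg hp]
    field_simp
  rw [hsum, funext hterm]
  exact (hasSum_pnat_inv_pow (by omega)).add ((summable_eisensteinTerm (-p) hz).hasSum.mul_left 2)

theorem pi_mul_cot_pi_natCast_mul (p : ℕ) (hz : 0 < z.im) (l : ℕ+) :
    ((l : ℂ) ^ (2 * p + 1))⁻¹ * (π * Complex.cot (π * (l * z))) =
      z⁻¹ * ((l : ℂ) ^ (2 * p + 2))⁻¹ + 2 * z * ∑' m : ℕ+, cotLatticeTerm p z (l, m) := by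
  have hz0 := ne_zero_of_im_pos hz
  have hl : (l : ℂ) ≠ 0 := by exact_mod_cast l.ne_zero
  have hterm (m : ℕ+) : 1 / ((l : ℂ) * z - m) + 1 / (l * z + m) =
      2 * (l : ℂ) ^ (2 * p + 1) * z * cotLatticeTerm p z (l, m) := by
    have hd := sq_mul_sq_sub_sq_ne_zero hz l m
    rw [← mul_pow, sq_sub_sq, mul_ne_zero_iff] at hd
    obtain ⟨hadd, hsub⟩ := hd
    rw [cotLatticeTerm, ← mul_pow, sq_sub_sq]
    field_simp
    ring
  rw [cot_series_rep (UpperHalfPlane.coe_mem_integerComplement ⟨_, natCast_mul_im_pos hz l⟩),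
    tsum_congr hterm, tsum_mul_left]
  field_simp
  ring

theorem hasSum_inv_pow_mul_pi_mul_cot {p : ℕ} (hp : p ≠ 0) (hz : 0 < z.im) :
    HasSum (fun l : ℕ+ => ((l : ℂ) ^ (2 * p + 1))⁻¹ * (π * Complex.cot (π * (l * z))))
      (z⁻¹ * riemannZeta (2 * p + 2 : ℕ) + 2 * z * ∑' x, cotLatticeTerm p z x) := by
  have hs := summable_cotLatticeTerm hp hz
  rw [funext (pi_mul_cot_pi_natCast_mul p hz)]
  exact ((hasSum_pnat_inv_pow (by omega)).mul_left z⁻¹).add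
    ((hs.hasSum.prod_fiberwise fun l => (hs.prod_factor l).hasSum).mul_left (2 * z))

theorem pi_mul_zeta_mul_eisensteinE_neg {p : ℕ} (hp : p ≠ 0) (hz : 0 < z.im) :
    π * (riemannZeta (2 * p + 1 : ℕ) * eisensteinE (-p) z) =
      I * (z⁻¹ * riemannZeta (2 * p + 2 : ℕ) + 2 * z * ∑' x, cotLatticeTerm p z x) := by
  refine ((hasSum_inv_pow_mul_I_mul_cot hp hz).mul_left (π : ℂ)).unique ?_
  convert (hasSum_inv_pow_mul_pi_mul_cot hp hz).mul_left I using 2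
  ring

theorem sum_antidiagonal_zeta_mul_zeta (n : ℕ) (z : ℂ) :
    ∑ i ∈ antidiagonal (n + 2),
        riemannZeta (2 * i.1 : ℕ) * riemannZeta (2 * i.2 : ℕ) * z ^ (2 * i.1) =
      -(riemannZeta (2 * (n + 2) : ℕ) * (1 + z ^ (2 * (n + 2)))) / 2 +
        ∑ i ∈ antidiagonal n, z ^ (2 * (i.1 + 1)) *
          (riemannZeta (2 * (i.2 + 1) : ℕ) * riemannZeta (2 * (i.1 + 1) : ℕ)) := by
  rw [Finset.Nat.sum_antidiagonal_succ, Finset.Nat.sum_antidiagonal_succ']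
  simp only [mul_zero, Nat.cast_zero, riemannZeta_zero, pow_zero]
  rw [Finset.sum_congr rfl fun i _ => (by ring :
    riemannZeta (2 * (i.1 + 1) : ℕ) * riemannZeta (2 * (i.2 + 1) : ℕ) * z ^ (2 * (i.1 + 1)) =
      z ^ (2 * (i.1 + 1)) *
        (riemannZeta (2 * (i.2 + 1) : ℕ) * riemannZeta (2 * (i.1 + 1) : ℕ)))]
  ring

/-- The polynomial `R_n(z) = ∑ B_{2i} B_{2j} / ((2i)! (2j)!) z^{2i}`, over `i + j = n`, of
Ramanujan's formula for the odd zeta values. -/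
noncomputable def ramanujanPolynomial (n : ℕ) (z : ℂ) : ℂ :=
  ∑ i ∈ antidiagonal n, (bernoulli (2 * i.1) / (2 * i.1).factorial : ℂ) *
    (bernoulli (2 * i.2) / (2 * i.2).factorial) * z ^ (2 * i.1)

theorem ramanujanPolynomial_zero (z : ℂ) : ramanujanPolynomial 0 z = 1 := by
  simp [ramanujanPolynomial]

theorem ramanujanPolynomial_one (z : ℂ) : ramanujanPolynomial 1 z = (1 + z ^ 2) / 12 := by
  simp [ramanujanPolynomial, Finset.Nat.antidiagonal_succ, bernoulli_two]
  ring

theorem riemannZeta_two_mul_natCast (n : ℕ) :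
    riemannZeta (2 * n : ℕ) = -(2 * π * I) ^ (2 * n) / 2 *
      (bernoulli (2 * n) / (2 * n).factorial) := by
  have hpow : (2 : ℂ) ^ (2 * n - 1 : ℤ) = 2 ^ (2 * n) / 2 := by
    rw [zpow_sub_one₀ two_ne_zero, div_eq_mul_inv]
    norm_cast
  push_cast
  rw [riemannZeta_two_mul_nat', hpow, mul_pow, pow_mul I, Complex.I_sq, mul_pow]
  ring

theorem sum_antidiagonal_zeta_mul_zeta_eq_ramanujanPolynomial (n : ℕ) (z : ℂ) :
    ∑ i ∈ antidiagonal n,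
        riemannZeta (2 * i.1 : ℕ) * riemannZeta (2 * i.2 : ℕ) * z ^ (2 * i.1) =
      (2 * π * I) ^ (2 * n) / 4 * ramanujanPolynomial n z := by
  rw [ramanujanPolynomial, Finset.mul_sum]
  refine Finset.sum_congr rfl fun i hi => ?_
  rw [← mem_antidiagonal.mp hi, riemannZeta_two_mul_natCast, riemannZeta_two_mul_natCast]
  ring

theorem pi_mul_I_mul_zeta_mul_eisensteinE_neg_sub (n : ℕ) (hz : 0 < z.im) :
    π * I * z * riemannZeta (2 * (n + 1) + 1 : ℕ) *
        (eisensteinE (-(n + 1 : ℕ)) z -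
          z ^ (2 * (n + 1)) * eisensteinE (-(n + 1 : ℕ)) (-1 / z)) =
      2 * ∑ i ∈ antidiagonal (n + 2),
        riemannZeta (2 * i.1 : ℕ) * riemannZeta (2 * i.2 : ℕ) * z ^ (2 * i.1) := by
  have hz0 := ne_zero_of_im_pos hz
  have hE := pi_mul_zeta_mul_eisensteinE_neg (p := n + 1) n.succ_ne_zero hz
  have hE' := pi_mul_zeta_mul_eisensteinE_neg (p := n + 1) n.succ_ne_zero (im_neg_one_div_pos hz)
  have hrec := tsum_cotLatticeTerm_reciprocity n hz
  rw [sum_antidiagonal_zeta_mul_zeta]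
  generalize ∑' x, cotLatticeTerm (n + 1) z x = S, ∑' x, cotLatticeTerm (n + 1) (-1 / z) x = S',
    eisensteinE (-(n + 1 : ℕ)) (-1 / z) = E' at *
  field_simp at hE hE'
  linear_combination I * hE - z ^ (2 * (n + 1)) * I * hE' - 2 * hrec +
    (riemannZeta (2 * (n + 2) : ℕ) * (1 + z ^ (2 * (n + 2))) + 2 * z ^ 2 * S +
      2 * z ^ (2 * (n + 1)) * S') * Complex.I_sq

theorem eisensteinE_neg_neg_one_div (n : ℕ) (hz : 0 < z.im) :
    eisensteinE (-(n + 1 : ℕ)) (-1 / z) = z ^ (2 * (-(n + 1 : ℕ) : ℤ)) *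
      (eisensteinE (-(n + 1 : ℕ)) z +
        (-2 * π * I) ^ (1 - 2 * (-(n + 1 : ℕ) : ℤ)) / eisensteinConst (-(n + 1 : ℕ)) *
          (ramanujanPolynomial (n + 2) z / z)) := by
  have hz0 := ne_zero_of_im_pos hz
  have hzeta := riemannZeta_natCast_ne_zero (n := 2 * (n + 1) + 1) (by omega)
  have h := pi_mul_I_mul_zeta_mul_eisensteinE_neg_sub n hz
  have hodd : (-2 * π * I) ^ (2 * (n + 1) + 1) = -(2 * π * I) ^ (2 * (n + 1) + 1) := by
    rw [← Odd.neg_pow ⟨n + 1, rfl⟩]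
    ring
  rw [sum_antidiagonal_zeta_mul_zeta_eq_ramanujanPolynomial] at h
  rw [eisensteinConst_neg n.succ_ne_zero,
    show 1 - 2 * (-(n + 1 : ℕ) : ℤ) = (2 * (n + 1) + 1 : ℕ) by push_cast; ring,
    show 2 * (-(n + 1 : ℕ) : ℤ) = -(2 * (n + 1) : ℕ) by push_cast; ring, zpow_neg, zpow_natCast,
    zpow_natCast, hodd, eq_inv_mul_iff_mul_eq₀ (pow_ne_zero _ hz0)]
  generalize eisensteinE (-(n + 1 : ℕ)) (-1 / z) = E' at h ⊢
  field_simp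
  refine mul_left_cancel₀ (mul_ne_zero (Complex.ofReal_ne_zero.mpr Real.pi_ne_zero)
    Complex.I_ne_zero) ?_
  linear_combination -h

theorem sum_Icc_bernoulli_eq_ramanujanPolynomial_div {k : ℤ} {n : ℕ} (hk : k + n = 1)
    (hz : z ≠ 0) :
    ∑ j ∈ Finset.Icc (0 : ℤ) (1 - k),
      (bernoulli (2 * j).toNat : ℂ) * (bernoulli (2 - 2 * k - 2 * j).toNat : ℂ) /
        ((Nat.factorial (2 * j).toNat : ℂ) * (Nat.factorial (2 - 2 * k - 2 * j).toNat : ℂ)) *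
        z ^ (1 - 2 * k - 2 * j) = ramanujanPolynomial n z / z := by
  rw [ramanujanPolynomial, Finset.sum_div]
  symm
  refine Finset.sum_nbij' (fun i => (i.2 : ℤ)) (fun j => ((n - j).toNat, j.toNat))
    (fun i hi => ?_) (fun j hj => ?_) (fun i hi => ?_) (fun j hj => ?_) (fun i hi => ?_)
  · rw [mem_antidiagonal] at hi
    rw [Finset.mem_Icc]
    omega
  · rw [Finset.mem_Icc] at hj
    rw [mem_antidiagonal]
    omega
  · rw [mem_antidiagonal] at hi
    ext <;> simp only <;> omega
  · rw [Finset.mem_Icc] at hj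
    simp only
    omega
  · rw [mem_antidiagonal] at hi
    rw [show (2 * (i.2 : ℤ)).toNat = 2 * i.2 by omega,
      show (2 - 2 * k - 2 * (i.2 : ℤ)).toNat = 2 * i.1 by omega,
      show 1 - 2 * k - 2 * (i.2 : ℤ) = (2 * i.1 : ℕ) - 1 by omega, zpow_sub_one₀ hz, zpow_natCast]
    ring

end

theorem corollary4p6 :
    (∀ (k : ℤ) (z : ℂ), 0 < z.im →
      eisensteinE k (-1 / z) =
        z ^ (2 * k) *
          (eisensteinE k z +
            (-2 * Real.pi * Complex.I) ^ (1 - 2 * k) / eisensteinConst k *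
              ((Complex.log z / (2 * Real.pi * Complex.I) - 1 / 4) * (if k = 0 then 1 else 0) +
                ∑ j ∈ Finset.Icc (0 : ℤ) (1 - k),
                  (bernoulli (2 * j).toNat : ℂ) * (bernoulli (2 - 2 * k - 2 * j).toNat : ℂ) /
                    ((Nat.factorial (2 * j).toNat : ℂ) *
                      (Nat.factorial (2 - 2 * k - 2 * j).toNat : ℂ)) *
                    z ^ (1 - 2 * k - 2 * j)))) ∧
    (∀ z : ℂ, 0 < z.im →
      eisensteinE 0 (-1 / z) =
        eisensteinE 0 z +
          1 / (Real.log (2 * Real.pi) : ℂ) *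
            (Complex.log z - Real.pi * Complex.I / 2 + Real.pi * Complex.I * z / 6 +
              Real.pi * Complex.I / (6 * z))) ∧
    (∀ z : ℂ, 0 < z.im →
      eisensteinE 1 (-1 / z) = z ^ 2 * eisensteinE 1 z + 6 * z / (Real.pi * Complex.I)) := by
  refine ⟨fun k z hz => ?_, fun z hz => eisensteinE_zero_neg_one_div hz,
    fun z hz => eisensteinE_one_neg_one_div hz⟩
  have hz0 := ne_zero_of_im_pos hz
  obtain hk | rfl | rfl | ⟨n, rfl⟩ : 2 ≤ k ∨ k = 1 ∨ k = 0 ∨ ∃ n : ℕ, k = -(n + 1 : ℕ) := by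
    obtain h | h := le_or_gt 0 k
    · omega
    · exact .inr (.inr (.inr ⟨(-k - 1).toNat, by omega⟩))
  · rw [if_neg (by omega), Finset.Icc_eq_empty (by omega), eisensteinE_neg_one_div_of_two_le hk hz]
    simp
  · rw [sum_Icc_bernoulli_eq_ramanujanPolynomial_div (n := 0) (by norm_num) hz0,
      ramanujanPolynomial_zero, eisensteinE_one_neg_one_div hz, eisensteinConst_one,
      if_neg one_ne_zero, mul_one, show (1 - 2 : ℤ) = -1 by norm_num, zpow_neg_one, zpow_ofNat]
    field_simp
    ring
  · have hlog : (Real.log (2 * Real.pi) : ℂ) ≠ 0 :=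
      Complex.ofReal_ne_zero.mpr (Real.log_pos (by linarith [Real.pi_gt_three])).ne'
    rw [sum_Icc_bernoulli_eq_ramanujanPolynomial_div (n := 1) (by norm_num) hz0,
      ramanujanPolynomial_one, eisensteinE_zero_neg_one_div hz, eisensteinConst_zero, if_pos rfl,
      mul_zero, sub_zero, zpow_zero, zpow_one]
    field_simp
    ring
  · rw [sum_Icc_bernoulli_eq_ramanujanPolynomial_div (n := n + 2) (by push_cast; ring) hz0,
      if_neg (by omega), mul_zero, zero_add, eisensteinE_neg_neg_one_div n hz]
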